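/- **Setting.** Consider $\dot x = f(x,u)$ with $x\in\mathbb R^n$, $u\in\mathcal U\subseteq\mathbb R^m$, where $f$ is Lipschitz continuous in $(x,u)$ on bounded subsets of $\mathbb R^n\times\mathcal U$. An input trajectory on $[0,T]$ is a bounded measurable function with values in $\mathcal U$; a state trajectory $x(\cdot)$ from $x_0$ is an absolutely continuous solution of $\dot x=f(x,u)$ a.e., $x(0)=x_0$. Let $h:\mathbb R^n\to\mathbb R$ be Lipschitz continuous, $\mathcal H=\{x : h(x)\ge 0\}\subseteq\mathcal D\subseteq\mathbb R^n$, and let $\mathcal F\subseteq\mathcal V$, where $\mathcal V$ is forward control invariant (from every point of $\mathcal V$ some input keeps the state in $\mathcal V$ for all $t\ge 0$) and $h\ge\delta>0$ on $\mathcal V$. Suppose that $\mathcal F$ can be reached in finite time from every $x_0\in\mathcal D$, let $\tau$ be the supremum over $x_0\in\mathcal D$ of the infimal time at which $\mathcal F$ can be reached from $x_0$, and let $T\ge\tau$, $T>0$, and $0<\gamma<\delta/T$. For $x_0\in\mathbb R^n$ put $$H_T(x_0)=\max_{u(\cdot)}\ \min_{t\in[0,T]}\ h(x(t))-\gamma t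 ,$$ the maximum being over all input trajectories on $[0,T]$ with a state trajectory from $x_0$ that satisfies $x(\vartheta)\in\mathcal F$ for some $\vartheta\in[0,T]$ (and $H_T(x_0)=-\infty$ if there are none). The maximum is assumed to be attained for every $x_0\in\mathcal D$; if $\mathcal U$ is bounded this is not needed, and $\max$ may be read as $\sup$. Assume that there is $M>0$ such that for every $x$ with $H_T(x)\ge0$ there is $u\in\mathcal U$ with $\|f(x,u)\|\le M$. Assume finally that $H_T$ is finite on a neighbourhood of each point of $\mathcal D$, differentiable at each point of $\mathcal D$, and locally Lipschitz: for some constant $L$, every $x\in\mathcal D$ has a neighbourhood on which $H_T$ is $L$-Lipschitz. **Definitions.** A class $\mathcal K$ function is a continuous strictly increasing function on $[0,\infty)$ vanishing at $0$; an extended class $\mathcal K_e$ function is a continuous strictly increasing function on $\mathbb R$ vanishing at $0$. With $dH(x;v)=\liminf_{\sigma\downarrow0}\frac{H(x+\sigma v)-H(x)}{\sigma}$, a locally Lipschitz function $H$ is a *CBF in the Dini sense* on $\mathcal D$ if there is an extended class $\mathcal K_e$ function $\alpha$ with $$\sup_{u\in\mathcal U} dH(x;f(x,u))\ \ge\ -\alpha(H(x))\qquad\text{for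 all }x\in\mathcal D. \tag{1}$$ A (differentiable) *CBF* on a domain is a function, differentiable at every point of the domain, that satisfies there the inequality (1) with the derivative of $H$ in direction $f(x,u)$ in place of $dH(x;f(x,u))$, for some extended class $\mathcal K_e$ function $\alpha$. **Claim.** $H_T$ is a CBF in the Dini sense on $\mathcal D$; in particular (1) holds for $H=H_T$ with some extended class $\mathcal K_e$ function $\alpha$. Moreover, let $\alpha$ be any extended class $\mathcal K_e$ function for which (1) holds with $H=H_T$; let $\Lambda\in\mathbb R$ be such that $\{x\in\mathbb R^n : H_T(x)\ge-\Lambda\}\subseteq\mathcal D$ (for instance the largest such number, if it exists); let $\widetilde\alpha$ be a convex or concave class $\mathcal K$ function with $\alpha(-\zeta)\le-\widetilde\alpha(\zeta)$ for all $\zeta\in[0,\Lambda]$; and let $\lambda:\mathbb R_{\ge0}\to[0,\Lambda]$ be differentiable (one-sidedly at $0$) with $\lambda'(t)\ge-\widetilde\alpha(\lambda(t))$ for all $t\ge0$. Then $(t,x)\mapsto H_T(x)+\lambda(t)$ is a CBF on $\mathbb R_{\ge0}\times\mathcal D$ for the time-augmented dynamics $\dot t=1$, $\dot x=f(x,u)$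 (derivatives at $t=0$ being taken relative to $\mathbb R_{\ge0}\times\mathbb R^n$). -/

import Mathlib

open Set Filter Topology MeasureTheory

noncomputable section

namespace PredictiveCBF

/-- Class `K` function: continuous and strictly increasing on `[0, ∞)`, zero at zero. -/
def IsClassK (a : ℝ → ℝ) : Prop :=
  ContinuousOn a (Ici 0) ∧ StrictMonoOn a (Ici 0) ∧ a 0 = 0

/-- Extended class `K` function: continuous and strictly increasing on `ℝ`, zero at zero. -/
def IsExtClassK (a : ℝ → ℝ) : Prop :=
  Continuous a ∧ StrictMono a ∧ a 0 = 0

section System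

variable {E V : Type*} [NormedAddCommGroup E] [NormedSpace ℝ E]
  [NormedAddCommGroup V] [MeasurableSpace V]

/-- Admissible inputs on `[0, T]`: measurable, bounded, with values in `U`. -/
def IsInput (U : Set V) (T : ℝ) (u : ℝ → V) : Prop :=
  Measurable u ∧ (∀ s ∈ Icc 0 T, u s ∈ U) ∧ ∃ R : ℝ, ∀ s ∈ Icc 0 T, ‖u s‖ ≤ R

/-- `x` is the state trajectory on `[0, T]` that starts in `x₀` and is driven by the admissible
input `u`: a Carathéodory solution (i.e. absolutely continuous, with `x' = f (x, u)` almost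
everywhere), written as an integral equation. -/
def IsTrajectory (f : E → V → E) (U : Set V) (T : ℝ) (x₀ : E) (u : ℝ → V) (x : ℝ → E) : Prop :=
  IsInput U T u ∧ ∀ t ∈ Icc 0 T,
    IntervalIntegrable (fun s => f (x s) (u s)) volume 0 t ∧
      x t = x₀ + ∫ s in (0 : ℝ)..t, f (x s) (u s)

/-- Forward control invariance: from every state of `W` some input keeps the state in `W` for
all future times. -/
def IsControlInvariant (f : E → V → E) (U : Set V) (W : Set E) : Prop :=
  ∀ x₀ ∈ W, ∃ (u : ℝ → V) (x : ℝ → E),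
    (∀ T : ℝ, 0 ≤ T → IsTrajectory f U T x₀ u x) ∧ ∀ t : ℝ, 0 ≤ t → x t ∈ W

/-- The times at which `F` can be reached from `x₀`. -/
def reachTimes (f : E → V → E) (U : Set V) (F : Set E) (x₀ : E) : Set ℝ :=
  {θ | 0 ≤ θ ∧ ∃ (u : ℝ → V) (x : ℝ → E), IsTrajectory f U θ x₀ u x ∧ x θ ∈ F}

/-- The worst case over `D` of the minimal time needed to reach `F`. -/
def worstReachTime (f : E → V → E) (U : Set V) (F D : Set E) : EReal :=
  ⨆ x₀ ∈ D, ⨅ θ ∈ reachTimes f U F x₀, (θ : EReal)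

/-- Feasible input-state pairs of the optimal control problem at `x₀`: trajectories on `[0, T]`
that visit `F` at some time in `[0, T]`. -/
def IsFeasible (f : E → V → E) (U : Set V) (F : Set E) (T : ℝ) (x₀ : E)
    (u : ℝ → V) (x : ℝ → E) : Prop :=
  IsTrajectory f U T x₀ u x ∧ ∃ θ ∈ Icc 0 T, x θ ∈ F

/-- The inner minimum of `h (x t) - γ t` over `t ∈ [0, T]`. -/
def cost (h : E → ℝ) (γ T : ℝ) (x : ℝ → E) : EReal :=
  ⨅ t ∈ Icc 0 T, ((h (x t) - γ * t : ℝ) : EReal)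

/-- The optimal value, in the extended reals; it is `⊥` where the problem is infeasible. -/
def value (f : E → V → E) (U : Set V) (F : Set E) (h : E → ℝ) (γ T : ℝ) (x₀ : E) : EReal :=
  ⨆ (u : ℝ → V) (x : ℝ → E) (_ : IsFeasible f U F T x₀ u x), cost h γ T x

/-- The optimal control problem at `x₀` has a solution, i.e. the supremum is a maximum. -/
def HasMaximizer (f : E → V → E) (U : Set V) (F : Set E) (h : E → ℝ) (γ T : ℝ)
    (x₀ : E) : Prop :=
  ∃ (u : ℝ → V) (x : ℝ → E), IsFeasible f U F T x₀ u x ∧ cost h γ T x = value f U F h γ T x₀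

/-- The function `H_T`, as a real-valued function (used where the value is finite). -/
def HT (f : E → V → E) (U : Set V) (F : Set E) (h : E → ℝ) (γ T : ℝ) (x₀ : E) : ℝ :=
  (value f U F h γ T x₀).toReal

/-- The superlevel set `{x | H_T x ≥ -l}` in the whole state space. -/
def superlevel (f : E → V → E) (U : Set V) (F : Set E) (h : E → ℝ) (γ T l : ℝ) : Set E :=
  {x | ((-l : ℝ) : EReal) ≤ value f U F h γ T x}

end System

section CBF

variable {X V : Type*} [NormedAddCommGroup X] [NormedSpace ℝ X]

/-- Lower right Dini derivative of `b` at `x` in direction `v`. -/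
def lowerDini (b : X → ℝ) (x v : X) : EReal :=
  liminf (fun σ : ℝ => (((b (x + σ • v) - b x) / σ : ℝ) : EReal)) (𝓝[>] 0)

/-- `sup_{u ∈ U} db(x; f(x,u)) ≥ -α (b x)` for all `x ∈ D`. -/
def DiniCBFInequality (f : X → V → X) (U : Set V) (D : Set X) (b : X → ℝ) (α : ℝ → ℝ) : Prop :=
  ∀ x ∈ D, ((-α (b x) : ℝ) : EReal) ≤ ⨆ u ∈ U, lowerDini b x (f x u)

/-- CBF in the Dini sense on `D`. -/
def IsDiniCBF (f : X → V → X) (U : Set V) (D : Set X) (b : X → ℝ) : Prop :=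
  (∀ x ∈ D, ∃ L, ∃ s ∈ 𝓝 x, LipschitzOnWith L b s) ∧
    ∃ α : ℝ → ℝ, IsExtClassK α ∧ DiniCBFInequality f U D b α

/-- Differentiable CBF on the domain `D`, for a system whose state space is the set `S`
(for instance `[0, ∞) × ℝⁿ` for a system augmented by time): `b` is differentiable, relative
to `S`, at every point of `D`, and `sup_{u ∈ U} Db(x) f(x,u) ≥ -α (b x)` on `D` for some
extended class `K` function `α`. -/
def IsCBF (S : Set X) (f : X → V → X) (U : Set V) (D : Set X) (b : X → ℝ) : Prop :=
  (∀ x ∈ D, DifferentiableWithinAt ℝ b S x) ∧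
    ∃ α : ℝ → ℝ, IsExtClassK α ∧
      ∀ x ∈ D, ((-α (b x) : ℝ) : EReal) ≤ ⨆ u ∈ U, ((fderivWithin ℝ b S x (f x u) : ℝ) : EReal)

/-- The dynamics augmented by time: `t' = 1`, `x' = f (x, u)`. -/
def timeAugmented (f : X → V → X) : ℝ × X → V → ℝ × X :=
  fun p u => (1, f p.2 u)

end CBF

end PredictiveCBF

end

/-!
Write `c = δ - γ T > 0` and `H = H_T`. The theorem rests on one growth estimate: at a point `x` of
`D` with `H x < c`, the inputs achieve `sup_u DH(x) f(x,u) ≥ γ` (`exists_fderiv_HT_ge`).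

To see this, take a nearly optimal trajectory `z` from `x` and follow it for a short time `s`. It
has not yet reached `F`, since `H ≥ c` on `F` (`le_value_of_mem`) and `H` is continuous. The tail of
`z`, continued after the visit to `F` by an input that keeps the state in the invariant set, is
feasible at `z s`; every point of it is now visited earlier by `s`, so its penalty `γ t` drops by
`γ s`, and on the continuation `h - γ t ≥ c`. Hence `H (z s) ≥ min (H x + γ s, c)` up to the
suboptimality of `z` (`min_le_value_tail`), and for small `s` the minimum is its first entry. On
the other hand, up to `o(s)` the increment `H (z s) - H x` is `DH(x) (z s - x)`, the integral over
`[0, s]` of the numbers `DH(x) f(z r, u r)`; these differ from `DH(x) f(x, u r)` by `O(s)`. If all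
`DH(x) f(x, u)` were below `γ - ε`, this would be a contradiction. The error terms are uniform in
the trajectory, because the inputs can be taken from one bounded set
(`exists_feasible_near_value`), also when the maximum is only a supremum and `z` varies with `s`.

Where `H x ≥ c`, an input with `‖f(x,u)‖ ≤ M` gives `DH(x) f(x,u) ≥ -L M`. So the Dini inequality
holds for any extended class `K` function that is at least `-γ` everywhere and at least `L M` on
`[c, ∞)` (`exists_isExtClassK_ge`).

For the time-varying function, that inequality and the condition on `λ` bound the supremum of the
derivatives below by `-(α(H x) + αt(λ t))`. The function `β z = max_{ζ ∈ [0, Λ]} α(z - ζ) + αt ζ` is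
of extended class `K`: it is continuous and strictly increasing as a maximum over a compact set, and
`β 0 = 0` follows from `α(-ζ) ≤ -αt ζ` (`exists_isExtClassK_add_le`). By construction
`α(H x) + αt(λ t) ≤ β(H x + λ t)`.
-/

namespace PredictiveCBF

/-! ### Shifting and concatenating trajectories -/

section Trajectories

variable {E V : Type*} [NormedAddCommGroup E] [NormedSpace ℝ E]
  [NormedAddCommGroup V] [MeasurableSpace V]
  {f : E → V → E} {U : Set V} {a b s : ℝ} {x₀ : E} {u w : ℝ → V} {x y : ℝ → E}

theorem IsTrajectory.mono (hx : IsTrajectory f U a x₀ u x) (hba : b ≤ a) :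
    IsTrajectory f U b x₀ u x := by
  have hsub : Icc 0 b ⊆ Icc 0 a := Icc_subset_Icc_right hba
  obtain ⟨⟨hm, hU, R, hR⟩, hint⟩ := hx
  exact ⟨⟨hm, fun s hs => hU s (hsub hs), R, fun s hs => hR s (hsub hs)⟩,
    fun t ht => hint t (hsub ht)⟩

theorem IsTrajectory.initial (hx : IsTrajectory f U a x₀ u x) (ha : 0 ≤ a) : x 0 = x₀ := by
  simpa using (hx.2 0 ⟨le_rfl, ha⟩).2

theorem IsTrajectory.continuousOn (hx : IsTrajectory f U a x₀ u x) (ha : 0 ≤ a) :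
    ContinuousOn x (Icc 0 a) := by
  have hc := intervalIntegral.continuousOn_primitive_interval' (hx.2 a ⟨ha, le_rfl⟩).1 left_mem_uIcc
  rw [uIcc_of_le ha] at hc
  exact (continuousOn_const.add hc).congr fun t ht => (hx.2 t ht).2

/-- The system is autonomous: the tail of a trajectory is a trajectory. -/
theorem IsTrajectory.shift (hx : IsTrajectory f U a x₀ u x) (hs : s ∈ Icc 0 a) :
    IsTrajectory f U (a - s) (x s) (fun t => u (t + s)) (fun t => x (t + s)) := by
  obtain ⟨⟨hm, hU, R, hR⟩, hint⟩ := hx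
  have hmem : ∀ t ∈ Icc 0 (a - s), t + s ∈ Icc 0 a := fun t ht =>
    ⟨add_nonneg ht.1 hs.1, by linarith [ht.2]⟩
  refine ⟨⟨hm.comp (measurable_id.add_const s), fun t ht => hU _ (hmem t ht), R,
    fun t ht => hR _ (hmem t ht)⟩, fun t ht => ?_⟩
  obtain ⟨hi, he⟩ := hint (t + s) (hmem t ht)
  obtain ⟨hi', he'⟩ := hint s hs
  have hi'' : IntervalIntegrable (fun r => f (x r) (u r)) volume s (t + s) := hi'.symm.trans hi
  refine ⟨by simpa using hi''.comp_add_right s, ?_⟩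
  change x (t + s) = _
  rw [intervalIntegral.integral_comp_add_right (fun r => f (x r) (u r)), zero_add, he, he',
    add_assoc, intervalIntegral.integral_add_adjacent_intervals hi' hi'']

/-- Concatenation of `p` on `[0, a]` with `q`, started at time `a`. -/
noncomputable def concat {α : Type*} (a : ℝ) (p q : ℝ → α) (t : ℝ) : α :=
  if t ≤ a then p t else q (t - a)

theorem concat_of_le {α : Type*} {p q : ℝ → α} {t : ℝ} (h : t ≤ a) : concat a p q t = p t :=
  if_pos h

theorem concat_of_lt {α : Type*} {p q : ℝ → α} {t : ℝ} (h : a < t) :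
    concat a p q t = q (t - a) := if_neg h.not_ge

theorem IsTrajectory.concat (hx : IsTrajectory f U a x₀ u x) (ha : 0 ≤ a)
    (hy : IsTrajectory f U b (x a) w y) :
    IsTrajectory f U (a + b) x₀ (concat a u w) (concat a x y) := by
  obtain ⟨⟨hm, hU, R, hR⟩, hint⟩ := hx
  obtain ⟨⟨hm', hU', R', hR'⟩, hint'⟩ := hy
  have hmem : ∀ t, a < t → t ≤ a + b → t - a ∈ Icc 0 b := fun t h1 h2 =>
    ⟨by linarith, by linarith⟩
  refine ⟨⟨hm.ite measurableSet_Iic (hm'.comp (measurable_id.sub_const a)), fun t ht => ?_,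
    max R R', fun t ht => ?_⟩, ?_⟩
  · rcases le_or_gt t a with h | h
    · rw [concat_of_le h]; exact hU t ⟨ht.1, h⟩
    · rw [concat_of_lt h]; exact hU' _ (hmem t h ht.2)
  · rcases le_or_gt t a with h | h
    · rw [concat_of_le h]; exact (hR t ⟨ht.1, h⟩).trans (le_max_left _ _)
    · rw [concat_of_lt h]; exact (hR' _ (hmem t h ht.2)).trans (le_max_right _ _)
  -- the equation on `[0, a]`
  have hfirst : ∀ t ∈ Icc 0 a,
      IntervalIntegrable (fun s => f (PredictiveCBF.concat a x y s)
        (PredictiveCBF.concat a u w s)) volume 0 t ∧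
      PredictiveCBF.concat a x y t = x₀ + ∫ s in (0 : ℝ)..t,
        f (PredictiveCBF.concat a x y s) (PredictiveCBF.concat a u w s) := by
    intro t ht
    have heq : EqOn (fun s => f (x s) (u s)) (fun s => f (PredictiveCBF.concat a x y s)
        (PredictiveCBF.concat a u w s)) (uIoc 0 t) := by
      intro r hr
      rw [uIoc_of_le ht.1] at hr
      simp only [concat_of_le (hr.2.trans ht.2)]
    obtain ⟨hi, he⟩ := hint t ht
    refine ⟨hi.congr heq, ?_⟩
    rw [concat_of_le ht.2, he,
      intervalIntegral.integral_congr_ae (Eventually.of_forall fun r hr => heq hr)]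
  intro t ht
  rcases le_or_gt t a with h | h
  · exact hfirst t ⟨ht.1, h⟩
  obtain ⟨hi, he⟩ := hfirst a ⟨ha, le_rfl⟩
  obtain ⟨hi', he'⟩ := hint' (t - a) (hmem t h ht.2)
  have heq : EqOn (fun s => f (y (s - a)) (w (s - a)))
      (fun s => f (PredictiveCBF.concat a x y s) (PredictiveCBF.concat a u w s))
      (uIoc a t) := by
    intro r hr
    rw [uIoc_of_le h.le] at hr
    simp only [concat_of_lt hr.1]
  have hi'' : IntervalIntegrable (fun s => f (PredictiveCBF.concat a x y s)
      (PredictiveCBF.concat a u w s)) volume a t := by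
    have := hi'.comp_sub_right a
    rw [zero_add, sub_add_cancel] at this
    exact this.congr heq
  refine ⟨hi.trans hi'', ?_⟩
  rw [← intervalIntegral.integral_add_adjacent_intervals hi hi'', ← add_assoc, ← he,
    concat_of_lt h, concat_of_le le_rfl, he',
    ← intervalIntegral.integral_congr_ae (Eventually.of_forall fun r hr => heq hr),
    intervalIntegral.integral_comp_sub_right (fun s => f (y s) (w s)), sub_self]

/-- A trajectory whose velocity is at most `B` while it stays in the unit ball around its initial
state moves at most by `B * t`, for times at which this bound has not yet reached `1`. -/
theorem IsTrajectory.norm_sub_le {B : ℝ} (hx : IsTrajectory f U a x₀ u x) (ha : 0 ≤ a)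
    (haB : B * a < 1) (hB0 : 0 ≤ B)
    (hB : ∀ t ∈ Icc 0 a, ‖x t - x₀‖ ≤ 1 → ‖f (x t) (u t)‖ ≤ B) :
    ∀ t ∈ Icc 0 a, ‖x t - x₀‖ ≤ B * t := by
  have key : ∀ t ∈ Icc 0 a, (∀ r ∈ Ioo 0 t, ‖x r - x₀‖ ≤ 1) → ‖x t - x₀‖ ≤ B * t := by
    intro t ht hr
    rw [(hx.2 t ht).2, add_sub_cancel_left]
    have := intervalIntegral.norm_integral_le_of_norm_le_const_ae (a := 0) (b := t) (C := B)
      (f := fun s => f (x s) (u s)) (by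
        have : ∀ᵐ r : ℝ, r ≠ t := by simp [ae_iff]
        filter_upwards [this] with r hrt hr0
        rw [uIoc_of_le ht.1] at hr0
        exact hB r ⟨hr0.1.le, hr0.2.trans ht.2⟩ (hr r ⟨hr0.1, lt_of_le_of_ne hr0.2 hrt⟩))
    rwa [sub_zero, abs_of_nonneg ht.1] at this
  suffices hone : ∀ t ∈ Icc 0 a, ‖x t - x₀‖ < 1 from fun t ht =>
    key t ht fun r hr => (hone r ⟨hr.1.le, hr.2.le.trans ht.2⟩).le
  by_contra! hne
  -- the first time at which the unit ball is left
  set S := {t ∈ Icc 0 a | 1 ≤ ‖x t - x₀‖} with hS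
  have hSne : S.Nonempty := hne
  have hcl : IsClosed S := by
    have := (((hx.continuousOn ha).sub continuousOn_const).norm).preimage_isClosed_of_isClosed
      isClosed_Icc (isClosed_Ici (a := (1 : ℝ))) (f := fun t => ‖x t - x₀‖)
    exact this
  have hbdd : BddBelow S := ⟨0, fun t ht => ht.1.1⟩
  have hmem := hcl.csInf_mem hSne hbdd
  have := key _ hmem.1 fun r hr => by
    by_contra! hlt
    exact absurd (csInf_le hbdd ⟨⟨hr.1.le, hr.2.le.trans hmem.1.2⟩, hlt.le⟩) hr.2.not_ge
  have h2 := mul_le_mul_of_nonneg_left hmem.1.2 hB0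
  linarith [hmem.2]

end Trajectories

/-! ### Lower bounds for the value function -/

section Value

variable {E V : Type*} [NormedAddCommGroup E] [NormedSpace ℝ E]
  [NormedAddCommGroup V] [MeasurableSpace V]
  {f : E → V → E} {U : Set V} {F W : Set E} {h : E → ℝ} {δ γ T : ℝ} {x₀ : E}
  {u : ℝ → V} {x : ℝ → E}

theorem coe_le_cost_iff {E : Type*} {h : E → ℝ} {x : ℝ → E} {r : ℝ} :
    (r : EReal) ≤ cost h γ T x ↔ ∀ t ∈ Icc 0 T, r ≤ h (x t) - γ * t := by
  simp only [cost, le_iInf_iff, EReal.coe_le_coe_iff]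

theorem cost_le_value (hx : IsFeasible f U F T x₀ u x) :
    cost h γ T x ≤ value f U F h γ T x₀ :=
  le_iSup_of_le u <| le_iSup_of_le x <| le_iSup_of_le hx le_rfl

/-- Once `F` is reached, an input that keeps the state in `W` guarantees the cost `δ - γ T`. -/
theorem le_value_of_mem (hT : 0 ≤ T) (hγ : 0 ≤ γ) (hFW : F ⊆ W)
    (hW : IsControlInvariant f U W) (hWδ : ∀ z ∈ W, δ ≤ h z) (hx₀ : x₀ ∈ F) :
    ((δ - γ * T : ℝ) : EReal) ≤ value f U F h γ T x₀ := by
  obtain ⟨w, y, hy, hyW⟩ := hW x₀ (hFW hx₀)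
  have hfeas : IsFeasible f U F T x₀ w y :=
    ⟨hy T hT, 0, ⟨le_rfl, hT⟩, by rwa [(hy T hT).initial hT]⟩
  refine (coe_le_cost_iff.2 fun t ht => ?_).trans (cost_le_value hfeas)
  have := hWδ _ (hyW t ht.1)
  have := mul_le_mul_of_nonneg_left ht.2 hγ
  linarith

/-- Growth of the value along a trajectory: until `F` is reached, the tail of a trajectory,
continued by an input that keeps the state in `W`, gains `γ` per unit of time, up to the level
`δ - γ T`. -/
theorem min_le_value_tail {r s θ : ℝ} (hγ : 0 ≤ γ) (hFW : F ⊆ W)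
    (hW : IsControlInvariant f U W) (hWδ : ∀ z ∈ W, δ ≤ h z)
    (hx : IsTrajectory f U T x₀ u x) (hθT : θ ≤ T) (hθF : x θ ∈ F)
    (hr : (r : EReal) ≤ cost h γ T x) (hs : 0 ≤ s) (hsθ : s ≤ θ) :
    ((min (r + γ * s) (δ - γ * T) : ℝ) : EReal) ≤ value f U F h γ T (x s) := by
  rw [coe_le_cost_iff] at hr
  obtain ⟨w, y, hy, hyW⟩ := hW (x θ) (hFW hθF)
  have htail := (hx.mono hθT).shift ⟨hs, hsθ⟩
  have hy' : IsTrajectory f U (T - (θ - s)) ((fun t => x (t + s)) (θ - s)) w y := by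
    simpa using hy (T - (θ - s)) (by linarith)
  have htraj := htail.concat (sub_nonneg.2 hsθ) hy'
  rw [add_sub_cancel] at htraj
  have hfeas : IsFeasible f U F T (x s) _ _ :=
    ⟨htraj, θ - s, ⟨sub_nonneg.2 hsθ, by linarith⟩, by
      rw [concat_of_le le_rfl, sub_add_cancel]; exact hθF⟩
  refine (coe_le_cost_iff.2 fun t ht => ?_).trans (cost_le_value hfeas)
  rcases le_or_gt t (θ - s) with hle | hlt
  · rw [concat_of_le hle]
    refine (min_le_left _ _).trans ?_
    have := hr (t + s) ⟨add_nonneg ht.1 hs, by linarith⟩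
    linarith
  · rw [concat_of_lt hlt]
    refine (min_le_right _ _).trans ?_
    have := hWδ _ (hyW (t - (θ - s)) (by linarith))
    have := mul_le_mul_of_nonneg_left ht.2 hγ
    linarith

/-- Feasible pairs of nearly optimal cost can be chosen with a common bound on the input. -/
theorem exists_feasible_near_value {v : ℝ}
    (hmax : Bornology.IsBounded U ∨ HasMaximizer f U F h γ T x₀)
    (hv : value f U F h γ T x₀ = v) :
    ∃ R : ℝ, ∀ ε > 0, ∃ (u : ℝ → V) (x : ℝ → E), IsFeasible f U F T x₀ u x ∧
      ((v - ε : ℝ) : EReal) ≤ cost h γ T x ∧ ∀ t ∈ Icc 0 T, ‖u t‖ ≤ R := by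
  rcases hmax with hU | ⟨u, x, hx, hc⟩
  · obtain ⟨R, hR⟩ := hU.exists_norm_le
    refine ⟨R, fun ε hε => ?_⟩
    have hlt : ((v - ε : ℝ) : EReal) < value f U F h γ T x₀ := by
      rw [hv, EReal.coe_lt_coe_iff]; linarith
    simp only [value, lt_iSup_iff] at hlt
    obtain ⟨u, x, hx, hlt⟩ := hlt
    exact ⟨u, x, hx, hlt.le, fun t ht => hR _ (hx.1.1.2.1 t ht)⟩
  · obtain ⟨R, hR⟩ := hx.1.1.2.2
    refine ⟨R, fun ε hε => ⟨u, x, hx, ?_, hR⟩⟩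
    rw [hc, hv, EReal.coe_le_coe_iff]
    linarith

end Value

/-! ### Infinitesimal growth of the value function below the level `δ - γ T` -/

section Growth

variable {E V : Type*} [NormedAddCommGroup E] [NormedSpace ℝ E]
  [NormedAddCommGroup V] [MeasurableSpace V]
  {f : E → V → E} {U : Set V} {F W : Set E} {h : E → ℝ} {δ γ T : ℝ} {x₀ : E}

theorem coe_HT (hfin : ∃ r : ℝ, value f U F h γ T x₀ = (r : EReal)) :
    value f U F h γ T x₀ = (HT f U F h γ T x₀ : EReal) := by
  obtain ⟨r, hr⟩ := hfin
  rw [HT, hr, EReal.toReal_coe]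

/-- Below the level `δ - γ T`, inputs achieve a directional derivative of `H_T` arbitrarily close
to `γ` or larger. Along nearly optimal trajectories `z` the value grows at rate `γ`, while its
increment up to a short time `s` is the derivative of `H_T` applied to an average of the
velocities `f (z r) (u r)`, which are uniformly close to the velocities `f x₀ (u r)`. -/
theorem exists_fderiv_HT_ge [CompleteSpace E]
    (hf : ∀ R : ℝ, ∃ K, LipschitzOnWith K (Function.uncurry f)
      (Metric.closedBall 0 R ×ˢ (U ∩ Metric.closedBall 0 R)))
    (hFW : F ⊆ W) (hW : IsControlInvariant f U W) (hWδ : ∀ z ∈ W, δ ≤ h z)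
    (hT : 0 < T) (hγ : 0 ≤ γ)
    (hmax : Bornology.IsBounded U ∨ HasMaximizer f U F h γ T x₀)
    (hfin : ∀ᶠ y in 𝓝 x₀, ∃ r : ℝ, value f U F h γ T y = (r : EReal))
    (hdiff : DifferentiableAt ℝ (HT f U F h γ T) x₀)
    (hlow : HT f U F h γ T x₀ < δ - γ * T) {ε : ℝ} (hε : 0 < ε) :
    ∃ u ∈ U, γ - ε ≤ fderiv ℝ (HT f U F h γ T) x₀ (f x₀ u) := by
  set H := HT f U F h γ T with hH
  set A := fderiv ℝ H x₀ with hA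
  by_contra! hcon
  obtain ⟨R, hR⟩ := exists_feasible_near_value hmax (coe_HT hfin.self_of_nhds)
  rw [← hH] at hR
  -- a ball containing the unit ball around `x₀` and the inputs in use
  set R' := max R (‖x₀‖ + 1)
  obtain ⟨K, hK⟩ := hf R'
  obtain ⟨B, hB1, hB⟩ : ∃ B : ℝ, 0 < B ∧ ∀ z u, ‖z‖ ≤ R' → u ∈ U → ‖u‖ ≤ R' → ‖f z u‖ ≤ B := by
    have hbdd : Bornology.IsBounded (Metric.closedBall (0 : E) R' ×ˢ
        (U ∩ Metric.closedBall (0 : V) R')) :=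
      Metric.isBounded_closedBall.prod (Metric.isBounded_closedBall.subset inter_subset_right)
    have himg : Bornology.IsBounded (Function.uncurry f '' (Metric.closedBall (0 : E) R' ×ˢ
        (U ∩ Metric.closedBall (0 : V) R'))) := by
      obtain ⟨C, hC⟩ := Metric.isBounded_iff.1 hbdd
      refine Metric.isBounded_iff.2 ⟨K * C, ?_⟩
      rintro _ ⟨p, hp, rfl⟩ _ ⟨q, hq, rfl⟩
      exact (hK.dist_le_mul p hp q hq).trans (by gcongr; exact hC hp hq)
    obtain ⟨C, hC⟩ := himg.exists_norm_le
    refine ⟨max C 1, by positivity, fun z u hz hu hu' => (hC _ ?_).trans (le_max_left _ _)⟩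
    exact ⟨(z, u), ⟨by simpa using hz, hu, by simpa using hu'⟩, rfl⟩
  -- a ball on which `H` is finite, below the level, and close to its linearization
  have hnear : ∀ᶠ y in 𝓝 x₀, (∃ r : ℝ, value f U F h γ T y = (r : EReal)) ∧
      H y < δ - γ * T ∧ ‖H y - H x₀ - A (y - x₀)‖ ≤ ε / (4 * B) * ‖y - x₀‖ :=
    hfin.and ((hdiff.continuousAt.eventually_lt_const hlow).and
      (hdiff.hasFDerivAt.isLittleO.bound (by positivity)))
  obtain ⟨ρ, hρ, hball⟩ := Metric.eventually_nhds_iff.1 hnear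
  have hlim : ∀ k : ℝ, Tendsto (fun s : ℝ => k * s) (𝓝[>] 0) (𝓝 0) := fun k =>
    ((continuous_const_mul k).tendsto' 0 0 (by simp)).mono_left nhdsWithin_le_nhds
  obtain ⟨s, ⟨hs0, hsT⟩, hs1, hsρ, hsA, hsγ⟩ :=
    ((show ∀ᶠ s in 𝓝[>] 0, s ∈ Ioo 0 T from Ioo_mem_nhdsGT hT).and <|
      ((hlim B).eventually_lt_const one_pos).and <|
      ((hlim B).eventually_lt_const hρ).and <|
      ((hlim (‖A‖ * K * B)).eventually_lt_const (show 0 < ε / 4 by positivity)).and <|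
      (hlim γ).eventually_lt_const (sub_pos.2 hlow)).exists
  obtain ⟨u, z, ⟨hz, θ, hθ, hzF⟩, hcost, hu⟩ := hR (s * (ε / 4)) (by positivity)
  have hz' := hz.mono hsT.le
  have hball' : ∀ t ∈ Icc 0 s, ‖z t - x₀‖ ≤ 1 → ‖z t‖ ≤ R' := fun t _ h1 => by
    have h2 := norm_add_le (z t - x₀) x₀
    rw [sub_add_cancel] at h2
    exact (by linarith : ‖z t‖ ≤ ‖x₀‖ + 1).trans (le_max_right _ _)
  have hx₀ : ‖x₀‖ ≤ R' := (by linarith : ‖x₀‖ ≤ ‖x₀‖ + 1).trans (le_max_right _ _)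
  have huU : ∀ t ∈ Icc 0 s, u t ∈ U := hz'.1.2.1
  have huR : ∀ t ∈ Icc 0 s, ‖u t‖ ≤ R' := fun t ht =>
    (hu t ⟨ht.1, ht.2.trans hsT.le⟩).trans (le_max_left _ _)
  have hmove : ∀ t ∈ Icc 0 s, ‖z t - x₀‖ ≤ B * t :=
    hz'.norm_sub_le hs0.le hs1 hB1.le fun t ht h1 => hB _ _ (hball' t ht h1) (huU t ht) (huR t ht)
  have hmove' : ∀ t ∈ Icc 0 s, ‖z t - x₀‖ ≤ B * s := fun t ht =>
    (hmove t ht).trans (mul_le_mul_of_nonneg_left ht.2 hB1.le)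
  have hzball : ∀ t ∈ Icc 0 s, dist (z t) x₀ < ρ := fun t ht => by
    rw [dist_eq_norm]; exact (hmove' t ht).trans_lt hsρ
  have hss : s ∈ Icc 0 s := ⟨hs0.le, le_rfl⟩
  -- `F` is not reached before time `s`, because `H ≥ δ - γ T` on `F`
  have hsθ : s ≤ θ := by
    by_contra! hlt
    obtain ⟨hr, hlt', -⟩ := hball (hzball θ ⟨hθ.1, hlt.le⟩)
    have := le_value_of_mem hT.le hγ hFW hW hWδ hzF
    rw [coe_HT hr, EReal.coe_le_coe_iff] at this
    exact hlt'.not_ge this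
  obtain ⟨hr, -, hlin⟩ := hball (hzball s hss)
  have hgrow := min_le_value_tail hγ hFW hW hWδ hz hθ.2 hzF hcost hs0.le hsθ
  rw [coe_HT hr, EReal.coe_le_coe_iff, ← hH, min_eq_left] at hgrow
  swap
  · have : 0 < s * (ε / 4) := by positivity
    linarith
  -- the linear part of the increment is an average of directional derivatives
  have hint : A (z s - x₀) ≤ s * (γ - ε + ‖A‖ * K * B * s) := by
    obtain ⟨hi, he⟩ := hz'.2 s hss
    rw [he, add_sub_cancel_left, ← A.intervalIntegral_comp_comm hi]
    have hmono := intervalIntegral.integral_mono_on (g := fun _ => γ - ε + ‖A‖ * K * B * s)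
      hs0.le (A.integrable_comp hi.1 |> fun h1 => ⟨h1, A.integrable_comp hi.2⟩ :
        IntervalIntegrable (fun r => A (f (z r) (u r))) volume 0 s)
      intervalIntegrable_const fun r hr => by
        have h1 := hmove' r hr
        have h2 : ‖f (z r) (u r) - f x₀ (u r)‖ ≤ K * ‖z r - x₀‖ := by
          have := hK.norm_sub_le (x := (z r, u r)) (y := (x₀, u r))
            ⟨by simpa using hball' r hr (h1.trans hs1.le), huU r hr, by simpa using huR r hr⟩
            ⟨by simpa using hx₀,
              huU r hr, by simpa using huR r hr⟩
          simpa [Function.uncurry, Prod.norm_def] using this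
        have h3 : A (f (z r) (u r)) - A (f x₀ (u r)) ≤ ‖A‖ * (K * (B * s)) := by
          rw [← map_sub]
          refine (le_abs_self _).trans ((A.le_opNorm _).trans ?_)
          gcongr
          exact h2.trans (by gcongr)
        have h4 := hcon _ (huU r hr)
        linarith
    rwa [intervalIntegral.integral_const, sub_zero, smul_eq_mul] at hmono
  have h1 : H (z s) - H x₀ - A (z s - x₀) ≤ ε / (4 * B) * (B * s) :=
    (le_abs_self _).trans (hlin.trans (by gcongr; exact hmove' s hss))
  have h2 : ε / (4 * B) * (B * s) = s * (ε / 4) := by field_simp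
  have h3 := mul_lt_mul_of_pos_left hsA hs0
  have h4 : 0 < s * (ε / 4) := by positivity
  linarith

end Growth

/-! ### Comparison functions -/

/-- The extended class `K` function used for `H_T`: it stays above `-γ` on the negative half-line
and has slope at least `k` on the positive one. -/
theorem exists_isExtClassK_ge {γ k : ℝ} (hγ : 0 < γ) (hk : 0 ≤ k) :
    ∃ α : ℝ → ℝ, IsExtClassK α ∧ (∀ r, -γ ≤ α r) ∧ ∀ r, 0 ≤ r → k * r ≤ α r := by
  refine ⟨fun r => γ / 2 * Real.arctan r + k * max r 0, ⟨?_, ?_, by simp⟩, fun r => ?_,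
    fun r hr => ?_⟩
  · fun_prop
  · have h1 : StrictMono fun r => γ / 2 * Real.arctan r :=
      Real.arctan_strictMono.const_mul (by positivity)
    have h2 : Monotone fun r : ℝ => k * max r 0 :=
      (monotone_id.max monotone_const).const_mul hk
    exact h1.add_monotone h2
  · have h1 : -2 ≤ Real.arctan r := by
      linarith [Real.neg_pi_div_two_lt_arctan r, Real.pi_le_four]
    have h2 : 0 ≤ k * max r 0 := by positivity
    have h3 := mul_le_mul_of_nonneg_left h1 (half_pos hγ).le
    linarith
  · have h1 : 0 ≤ Real.arctan r := Real.arctan_nonneg.2 hr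
    have h2 : 0 ≤ γ / 2 * Real.arctan r := by positivity
    simpa [max_eq_left hr] using h2

/-- The comparison function for `H + λ` is `z ↦ max_{ζ ∈ [0, Λ]} α (z - ζ) + αt ζ`. It vanishes at
`0` because `αt ζ ≤ -α (-ζ)`, with equality for `ζ = 0`. -/
theorem exists_isExtClassK_add_le {α αt : ℝ → ℝ} {Λ : ℝ} (hα : IsExtClassK α)
    (hαt : IsClassK αt) (hΛ : 0 ≤ Λ) (hle : ∀ ζ ∈ Icc 0 Λ, α (-ζ) ≤ -αt ζ) :
    ∃ β : ℝ → ℝ, IsExtClassK β ∧ ∀ r, ∀ ζ ∈ Icc 0 Λ, α r + αt ζ ≤ β (r + ζ) := by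
  set g : ℝ → ℝ → ℝ := fun z ζ => α (z - ζ) + αt (max ζ 0) with hg
  have hgc : Continuous ↿g := by
    have h1 : Continuous fun ζ : ℝ => αt (max ζ 0) :=
      hαt.1.comp_continuous (by fun_prop) fun ζ => mem_Ici.2 (le_max_right _ _)
    exact (hα.1.comp (continuous_fst.sub continuous_snd)).add (h1.comp continuous_snd)
  have hne : (Icc 0 Λ).Nonempty := ⟨0, le_rfl, hΛ⟩
  have hgz : ∀ z, ContinuousOn (g z) (Icc 0 Λ) := fun z =>
    (hgc.comp (Continuous.prodMk_right z)).continuousOn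
  have hbdd : ∀ z, BddAbove (g z '' Icc 0 Λ) := fun z => isCompact_Icc.bddAbove_image (hgz z)
  have hle_sup : ∀ z, ∀ ζ ∈ Icc 0 Λ, g z ζ ≤ sSup (g z '' Icc 0 Λ) := fun z ζ hζ =>
    le_csSup (hbdd z) (mem_image_of_mem _ hζ)
  refine ⟨fun z => sSup (g z '' Icc 0 Λ), ⟨isCompact_Icc.continuous_sSup hgc, ?_, ?_⟩, ?_⟩
  · intro z z' hzz
    obtain ⟨ζ, hζ, hmax⟩ := isCompact_Icc.exists_sSup_image_eq hne (hgz z)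
    simp only
    rw [hmax]
    refine lt_of_lt_of_le ?_ (hle_sup z' ζ hζ)
    exact add_lt_add_left (hα.2.1 (sub_lt_sub_right hzz ζ)) _
  · refine le_antisymm (csSup_le (hne.image _) ?_) ?_
    · rintro _ ⟨ζ, hζ, rfl⟩
      have := hle ζ hζ
      simp only [hg, zero_sub, max_eq_left hζ.1]
      linarith
    · simpa [hg, hα.2.2, hαt.2.2] using hle_sup 0 0 ⟨le_rfl, hΛ⟩
  · intro r ζ hζ
    simpa [hg, max_eq_left hζ.1] using hle_sup (r + ζ) ζ hζ

/-! ### Directional derivatives and suprema over inputs -/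

theorem coe_le_biSup_coe_iff {ι : Type*} {U : Set ι} {g : ι → ℝ} {a : ℝ} :
    (a : EReal) ≤ ⨆ u ∈ U, (g u : EReal) ↔ ∀ ε > 0, ∃ u ∈ U, a - ε ≤ g u := by
  constructor
  · intro ha ε hε
    have hlt : ((a - ε : ℝ) : EReal) < ⨆ u ∈ U, (g u : EReal) :=
      lt_of_lt_of_le (EReal.coe_lt_coe_iff.2 (by linarith)) ha
    obtain ⟨u, hu, hlt⟩ := lt_biSup_iff.1 hlt
    exact ⟨u, hu, (EReal.coe_lt_coe_iff.1 hlt).le⟩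
  · intro hε
    by_contra! hlt
    obtain ⟨r, h1, h2⟩ := EReal.lt_iff_exists_real_btwn.1 hlt
    obtain ⟨u, hu, hru⟩ := hε (a - r) (sub_pos.2 (EReal.coe_lt_coe_iff.1 h2))
    have hle : (g u : EReal) ≤ ⨆ u ∈ U, (g u : EReal) :=
      le_iSup₂ (f := fun u _ => (g u : EReal)) u hu
    exact (hle.trans_lt h1).not_ge (EReal.coe_le_coe_iff.2 (by linarith))

section Derivatives

variable {X V : Type*} [NormedAddCommGroup X] [NormedSpace ℝ X]

theorem lowerDini_eq_fderiv {b : X → ℝ} {x : X} (hb : DifferentiableAt ℝ b x) (v : X) :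
    lowerDini b x v = ((fderiv ℝ b x v : ℝ) : EReal) := by
  have h := (hb.hasFDerivAt.hasLineDerivAt v).tendsto_slope_zero_right
  refine (((continuous_coe_real_ereal.tendsto _).comp h).congr fun σ => ?_).liminf_eq
  simp [div_eq_inv_mul]

/-- For a differentiable function, the Dini inequality is an inequality for the derivative. -/
theorem le_biSup_lowerDini_iff {f : X → V → X} {U : Set V} {b : X → ℝ} {x : X} {a : ℝ}
    (hb : DifferentiableAt ℝ b x) :
    (a : EReal) ≤ ⨆ u ∈ U, lowerDini b x (f x u) ↔
      ∀ ε > 0, ∃ u ∈ U, a - ε ≤ fderiv ℝ b x (f x u) := by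
  simp only [lowerDini_eq_fderiv hb, coe_le_biSup_coe_iff]

theorem hasFDerivWithinAt_add_time {H : X → ℝ} {l : ℝ → ℝ} {p : ℝ × X}
    (hH : DifferentiableAt ℝ H p.2) (hl : DifferentiableWithinAt ℝ l (Ici 0) p.1) :
    HasFDerivWithinAt (fun q : ℝ × X => H q.2 + l q.1)
      ((fderiv ℝ H p.2).comp (ContinuousLinearMap.snd ℝ ℝ X) +
        (fderivWithin ℝ l (Ici 0) p.1).comp (ContinuousLinearMap.fst ℝ ℝ X))
      (Ici 0 ×ˢ univ) p :=
  (hH.hasFDerivAt.comp p hasFDerivAt_snd).hasFDerivWithinAt.add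
    (hl.hasFDerivWithinAt.comp p hasFDerivWithinAt_fst fun _ hq => hq.1)

/-- A differentiable function satisfying the Dini inequality with `α` stays a CBF, for the
time-augmented dynamics, after adding a function of time that decays no faster than `αt`
allows. -/
theorem isCBF_add_time {f : X → V → X} {U : Set V} {D : Set X} {H : X → ℝ} {α αt l : ℝ → ℝ}
    {Λ : ℝ} (hH : ∀ x ∈ D, DifferentiableAt ℝ H x) (hα : IsExtClassK α)
    (hDini : DiniCBFInequality f U D H α) (hαt : IsClassK αt)
    (hle : ∀ ζ ∈ Icc 0 Λ, α (-ζ) ≤ -αt ζ) (hl : ∀ t ∈ Ici (0 : ℝ), l t ∈ Icc 0 Λ)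
    (hld : DifferentiableOn ℝ l (Ici 0))
    (hl' : ∀ t ∈ Ici (0 : ℝ), -αt (l t) ≤ derivWithin l (Ici 0) t) :
    IsCBF (Ici 0 ×ˢ univ) (timeAugmented f) U (Ici 0 ×ˢ D) (fun p => H p.2 + l p.1) := by
  have hΛ : 0 ≤ Λ := (hl 0 self_mem_Ici).1.trans (hl 0 self_mem_Ici).2
  obtain ⟨β, hβ, hβle⟩ := exists_isExtClassK_add_le hα hαt hΛ hle
  have hderiv := fun (p : ℝ × X) (hp : p ∈ Ici (0 : ℝ) ×ˢ D) =>
    hasFDerivWithinAt_add_time (hH p.2 hp.2) (hld p.1 hp.1)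
  refine ⟨fun p hp => (hderiv p hp).differentiableWithinAt, β, hβ, fun p hp => ?_⟩
  have huniq : UniqueDiffWithinAt ℝ (Ici (0 : ℝ) ×ˢ (univ : Set X)) p :=
    (uniqueDiffOn_Ici 0).prod uniqueDiffOn_univ p ⟨hp.1, mem_univ _⟩
  rw [coe_le_biSup_coe_iff, (hderiv p hp).fderivWithin huniq]
  intro ε hε
  obtain ⟨u, hu, hle⟩ := (le_biSup_lowerDini_iff (hH p.2 hp.2)).1 (hDini p.2 hp.2) ε hε
  refine ⟨u, hu, ?_⟩
  have h1 := hβle (H p.2) _ (hl p.1 hp.1)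
  have h2 := hl' p.1 hp.1
  rw [derivWithin] at h2
  simp only [timeAugmented, _root_.add_apply, ContinuousLinearMap.comp_apply,
    ContinuousLinearMap.coe_snd', ContinuousLinearMap.coe_fst']
  linarith

end Derivatives

end PredictiveCBF

/-! ### The barrier property of `H_T` and of `H_T + λ` -/

theorem mainTheorem6 {n m : ℕ}
    (f : EuclideanSpace ℝ (Fin n) → EuclideanSpace ℝ (Fin m) → EuclideanSpace ℝ (Fin n))
    (U : Set (EuclideanSpace ℝ (Fin m)))
    (hf : ∀ R : ℝ, ∃ K, LipschitzOnWith K (Function.uncurry f)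
      (Metric.closedBall 0 R ×ˢ (U ∩ Metric.closedBall 0 R)))
    (h : EuclideanSpace ℝ (Fin n) → ℝ) (hh : ∃ K, LipschitzWith K h)
    (F W D : Set (EuclideanSpace ℝ (Fin n))) (δ γ T M : ℝ)
    -- `F` lies in a forward control invariant set `W` on which `h ≥ δ > 0`
    (hδ : 0 < δ) (hFW : F ⊆ W) (hW : PredictiveCBF.IsControlInvariant f U W)
    (hWδ : ∀ x ∈ W, δ ≤ h x)
    -- `F` is reachable in finite time from every state of `D`, and `T` is at least the worst time
    (hreach : ∀ x ∈ D, (PredictiveCBF.reachTimes f U F x).Nonempty)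
    (hT : 0 < T) (hτ : PredictiveCBF.worstReachTime f U F D ≤ (T : EReal))
    (hHD : {x | 0 ≤ h x} ⊆ D)
    (hγ : 0 < γ) (hγT : γ < δ / T)
    (hM : 0 < M)
    (hfM : ∀ x ∈ PredictiveCBF.superlevel f U F h γ T 0, ∃ u ∈ U, ‖f x u‖ ≤ M)
    -- the maximum defining `H_T` is attained (not needed if `U` is bounded)
    (hmax : Bornology.IsBounded U ∨ ∀ x ∈ D, PredictiveCBF.HasMaximizer f U F h γ T x)
    -- `H_T` is real-valued near `D`, locally Lipschitz and differentiable
    (hfin : ∀ x ∈ D, ∀ᶠ y in 𝓝 x, ∃ r : ℝ, PredictiveCBF.value f U F h γ T y = (r : EReal))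
    (hLip : ∃ L, ∀ x ∈ D, ∃ s ∈ 𝓝 x, LipschitzOnWith L (PredictiveCBF.HT f U F h γ T) s)
    (hdiff : ∀ x ∈ D, DifferentiableAt ℝ (PredictiveCBF.HT f U F h γ T) x) :
    PredictiveCBF.IsDiniCBF f U D (PredictiveCBF.HT f U F h γ T) ∧
    ∀ α : ℝ → ℝ, PredictiveCBF.IsExtClassK α →
      PredictiveCBF.DiniCBFInequality f U D (PredictiveCBF.HT f U F h γ T) α →
      ∀ Λ : ℝ, PredictiveCBF.superlevel f U F h γ T Λ ⊆ D →
      ∀ αt : ℝ → ℝ, PredictiveCBF.IsClassK αt →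
        (ConvexOn ℝ (Ici 0) αt ∨ ConcaveOn ℝ (Ici 0) αt) →
        (∀ ζ ∈ Icc 0 Λ, α (-ζ) ≤ -αt ζ) →
      ∀ l : ℝ → ℝ, (∀ t ∈ Ici (0 : ℝ), l t ∈ Icc 0 Λ) → DifferentiableOn ℝ l (Ici 0) →
        (∀ t ∈ Ici (0 : ℝ), -αt (l t) ≤ derivWithin l (Ici 0) t) →
      PredictiveCBF.IsCBF (Ici 0 ×ˢ univ) (PredictiveCBF.timeAugmented f) U (Ici 0 ×ˢ D)
        (fun p : ℝ × EuclideanSpace ℝ (Fin n) =>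
          PredictiveCBF.HT f U F h γ T p.2 + l p.1) := by
  have hc : 0 < δ - γ * T := sub_pos.2 ((lt_div_iff₀ hT).1 hγT)
  refine ⟨⟨fun x hx => let ⟨L, hL⟩ := hLip; ⟨L, hL x hx⟩, ?_⟩, fun α hα hDini Λ _ αt hαt _ hle l hl
    hld hl' => PredictiveCBF.isCBF_add_time hdiff hα hDini hαt hle hl hld hl'⟩
  obtain ⟨L, hL⟩ := hLip
  -- the slope for which `α (δ - γ T) ≥ L M`
  obtain ⟨α, hα, hαγ, hαL⟩ := PredictiveCBF.exists_isExtClassK_ge hγ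
    (k := L * M / (δ - γ * T)) (by positivity)
  refine ⟨α, hα, fun x hx => (PredictiveCBF.le_biSup_lowerDini_iff (hdiff x hx)).2 fun ε hε => ?_⟩
  rcases lt_or_ge (PredictiveCBF.HT f U F h γ T x) (δ - γ * T) with hlow | hhigh
  · obtain ⟨u, hu, hge⟩ := PredictiveCBF.exists_fderiv_HT_ge hf hFW hW hWδ hT hγ.le
      (hmax.imp_right fun H => H x hx) (hfin x hx) (hdiff x hx) hlow hε
    exact ⟨u, hu, by linarith [hαγ (PredictiveCBF.HT f U F h γ T x)]⟩
  · obtain ⟨u, hu, huM⟩ := hfM x (by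
      rw [PredictiveCBF.superlevel, mem_ofPred_eq, PredictiveCBF.coe_HT (hfin x hx).self_of_nhds,
        EReal.coe_le_coe_iff]
      linarith)
    refine ⟨u, hu, ?_⟩
    obtain ⟨s, hs, hLs⟩ := hL x hx
    have h1 : ‖fderiv ℝ (PredictiveCBF.HT f U F h γ T) x (f x u)‖ ≤ L * M :=
      ((fderiv ℝ _ x).le_opNorm _).trans
        (mul_le_mul (norm_fderiv_le_of_lipschitzOn ℝ hs hLs) huM (norm_nonneg _) L.2)
    have h2 : L * M ≤ α (PredictiveCBF.HT f U F h γ T x) := by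
      refine le_trans ?_ (hαL _ (hc.le.trans hhigh))
      rw [div_mul_eq_mul_div, le_div_iff₀ hc]
      gcongr
    linarith [(abs_le.1 h1).1]
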